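/- Let $\mathbb F$ be a finite field and $n$ a positive integer coprime to $|\mathbb F|$. Let $A=\mathbb F[x]/\langle x^n-1\rangle$, and let $x^n-1=\pi_1\cdots\pi_r$ with pairwise different monic irreducible $\pi_k\in\mathbb F[x]$, ordered by nondecreasing degree. Let $\varepsilon_k\in A$ be the primitive idempotent with $\varepsilon_k\equiv 1 \pmod{\pi_k}$ and $\varepsilon_k\equiv 0\pmod{\pi_j}$ for $j\neq k$. Let $\sigma$ be an $\mathbb F$-algebra automorphism of $A$, and let $A[z;\sigma]$ be the skew polynomial ring whose elements are written $\sum_j z^ja_j$ with $a_j\in A$, with the usual addition and with the multiplication determined by $az=z\,\sigma(a)$ for $a\in A$. Identify $\mathbb F[z]^n$ with $A[z;\sigma]$ through $$\mathfrak p:\ \sum_j z^jv_j\longmapsto\sum_j z^j\sum_{i=0}^{n-1}v_{j,i}\,x^i ,\qquad v_j=(v_{j,0},\dots,v_{j,n-1})\in\mathbb F^n .$$ A convolutional code is a submodule $\mathcal C=\operatorname{im}G=\{uG\mid u\in\mathbb F[z]^k\}$ of $\mathbb F[z]^n$ with a right invertible $G\in\mathbb F[z]^{k\times n}$ (equivalently,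 a direct summand of $\mathbb F[z]^n$). Its complexity is the maximal degree of the $k\times k$ minors of $G$; it does not depend on the choice of $G$. The code $\mathcal C$ is $\sigma$-cyclic if $\mathfrak p(\mathcal C)$ is a left ideal of $A[z;\sigma]$. For $f\in A[z;\sigma]$ put $f^{(k)}=\varepsilon_kf$. Order the monomials $z^\mu\varepsilon_k$ by $z^\mu\varepsilon_k<z^\nu\varepsilon_l$ iff $\mu<\nu$, or $\mu=\nu$ and $k<l$; the leading monomial of $f=\sum_\nu z^\nu f_\nu\neq0$ is the largest $z^\mu\varepsilon_k$ with $\varepsilon_kf_\mu\neq0$, and the terms of $f$ are the $z^\nu\varepsilon_lf_\nu$. Call $f$ reduced if for all $k\neq l$ with $f^{(l)}\neq0$ no nonzero term of $f^{(k)}$ is right divisible by the leading monomial of $f^{(l)}$. A generator polynomial of a $\sigma$-cyclic code $\mathcal C$ is a reduced $g$ with $\mathfrak p(\mathcal C)=\{fg\mid f\in A[z;\sigma]\}$. A $\sigma$-cyclic code $\mathcal C\neq\{0\}$ is minimal if it has a generator polynomial $g$ with $g=g^{(l)}$ for some $l$. **Lemma.** Let $\mathcal C\subseteq\mathbb F[z]^n$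 be a minimal $\sigma$-cyclic code with generator polynomial $g=g^{(l)}$. Then $\mathcal C$ has complexity zero if and only if $g=g\,\varepsilon_l$. Furthermore, if $\mathcal C$ has nonzero complexity, then $\sigma(\varepsilon_l)\neq\varepsilon_l$. -/

import Mathlib

noncomputable section

namespace CyclicConv

open Polynomial

/-! ### Skew polynomials with right coefficients -/

/-- The skew polynomial ring `R[z;σ]`. Its elements are written with right coefficients: the
element with coefficient family `f_0, f_1, …` stands for `∑ z ^ j * f_j`. As an additive group it
is `R[z]`; its multiplication is determined by `a * z = z * σ a`. -/
structure PiretAlgebra {F R : Type*} [CommSemiring F] [CommRing R] [Algebra F R]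
    (σ : R ≃ₐ[F] R) where
  toPoly : R[X]

namespace PiretAlgebra

variable {F R : Type*} [CommSemiring F] [CommRing R] [Algebra F R] (σ : R ≃ₐ[F] R)

/-- The identification with the polynomials with coefficients in `R`, as sets. -/
def equivPoly : PiretAlgebra σ ≃ R[X] where
  toFun := toPoly
  invFun := mk

instance : AddCommGroup (PiretAlgebra σ) := (equivPoly σ).addCommGroup

/-- The term `z ^ j * a`, as an additive map in the right coefficient `a`. -/
def term (j : ℕ) : R →+ PiretAlgebra σ where
  toFun a := ⟨Polynomial.monomial j a⟩
  map_zero' := congrArg mk (map_zero _)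
  map_add' a b := congrArg mk (map_add _ a b)

variable {σ}

/-- The right coefficient of `z ^ j`. -/
def coeff (f : PiretAlgebra σ) (j : ℕ) : R := f.toPoly.coeff j

/-- `(∑ z ^ j a_j) * (∑ z ^ l b_l) = ∑ z ^ (j + l) (σ ^ l) (a_j) b_l`. -/
instance : Mul (PiretAlgebra σ) where
  mul f g := ⟨f.toPoly.sum fun j a => g.toPoly.sum fun l b =>
    Polynomial.monomial (j + l) ((σ ^ l) a * b)⟩

instance : One (PiretAlgebra σ) where
  one := term σ 0 1

theorem toPoly_mul (f g : PiretAlgebra σ) :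
    (f * g).toPoly = f.toPoly.sum fun j a => g.toPoly.sum fun l b =>
      Polynomial.monomial (j + l) ((σ ^ l) a * b) := rfl

theorem one_def : (1 : PiretAlgebra σ) = term σ 0 1 := rfl

theorem toPoly_add (f g : PiretAlgebra σ) : (f + g).toPoly = f.toPoly + g.toPoly := rfl

theorem toPoly_zero : (0 : PiretAlgebra σ).toPoly = 0 := rfl

theorem toPoly_term (j : ℕ) (a : R) : (term σ j a).toPoly = Polynomial.monomial j a := rfl

theorem toPoly_injective : Function.Injective (toPoly : PiretAlgebra σ → R[X]) :=
  (equivPoly σ).injective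

theorem induction_on {P : PiretAlgebra σ → Prop} (f : PiretAlgebra σ)
    (add : ∀ f g, P f → P g → P (f + g)) (mon : ∀ j a, P (term σ j a)) : P f := by
  obtain ⟨f⟩ := f
  induction f using Polynomial.induction_on' with
  | add f g hf hg => exact add _ _ hf hg
  | monomial j a => exact mon j a

theorem add_mul' (f g h : PiretAlgebra σ) : (f + g) * h = f * h + g * h := by
  apply toPoly_injective
  simp only [toPoly_mul, toPoly_add]
  refine Polynomial.sum_add_index _ _ _ (fun j => ?_) (fun j a b => ?_)
  · simp [Polynomial.sum]
  · simp only [map_add, add_mul, Polynomial.sum, Finset.sum_add_distrib]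

theorem mul_add' (f g h : PiretAlgebra σ) : f * (g + h) = f * g + f * h := by
  apply toPoly_injective
  simp only [toPoly_mul, toPoly_add]
  have key : ∀ (j : ℕ) (a : R), ((g.toPoly + h.toPoly).sum fun l b =>
      Polynomial.monomial (j + l) ((σ ^ l) a * b)) =
      (g.toPoly.sum fun l b => Polynomial.monomial (j + l) ((σ ^ l) a * b)) +
        h.toPoly.sum fun l b => Polynomial.monomial (j + l) ((σ ^ l) a * b) := by
    intro j a
    refine Polynomial.sum_add_index _ _ _ (fun l => ?_) (fun l b c => ?_)
    · simp
    · simp only [mul_add, map_add]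
  simp only [key]
  simp only [Polynomial.sum, Finset.sum_add_distrib]

theorem zero_mul' (f : PiretAlgebra σ) : 0 * f = 0 := by
  apply toPoly_injective
  rw [toPoly_mul, toPoly_zero]
  exact Polynomial.sum_zero_index _

theorem mul_zero' (f : PiretAlgebra σ) : f * 0 = 0 := by
  have h := mul_add' f 0 0
  rw [add_zero] at h
  exact left_eq_add.mp h

theorem term_mul_term (j l : ℕ) (a b : R) :
    term σ j a * term σ l b = term σ (j + l) ((σ ^ l) a * b) := by
  apply toPoly_injective
  simp only [toPoly_mul, toPoly_term]
  rw [Polynomial.sum_monomial_index, Polynomial.sum_monomial_index]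
  · simp
  · simp [Polynomial.sum]

instance : Ring (PiretAlgebra σ) where
  __ : AddCommGroup (PiretAlgebra σ) := inferInstance
  left_distrib := mul_add'
  right_distrib := add_mul'
  zero_mul := zero_mul'
  mul_zero := mul_zero'
  mul_assoc f g h := by
    induction f using induction_on with
    | add f₁ f₂ h₁ h₂ => rw [add_mul', add_mul', add_mul', h₁, h₂]
    | mon i a =>
      induction g using induction_on with
      | add g₁ g₂ h₁ h₂ => rw [mul_add', add_mul', add_mul', mul_add', h₁, h₂]
      | mon j b =>
        induction h using induction_on with
        | add k₁ k₂ h₁ h₂ => rw [mul_add', mul_add', mul_add', h₁, h₂]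
        | mon k c =>
          simp only [term_mul_term, map_mul]
          rw [← AlgEquiv.mul_apply, ← pow_add, add_assoc, add_comm k j, mul_assoc]
  one_mul f := by
    induction f using induction_on with
    | add f₁ f₂ h₁ h₂ => rw [mul_add', h₁, h₂]
    | mon i a => rw [one_def, term_mul_term]; simp
  mul_one f := by
    induction f using induction_on with
    | add f₁ f₂ h₁ h₂ => rw [add_mul', h₁, h₂]
    | mon i a => rw [one_def, term_mul_term]; simp

variable (σ) in
/-- The embedding of the coefficient ring as the subring of constants. -/
def C : R →+* PiretAlgebra σ where
  toFun a := term σ 0 a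
  map_one' := rfl
  map_mul' a b := by rw [term_mul_term]; simp
  map_zero' := map_zero _
  map_add' := map_add _

variable (σ) in
/-- The indeterminate. -/
def z : PiretAlgebra σ := term σ 1 1

theorem C_mul_z (a : R) : C σ a * z σ = z σ * C σ (σ a) := by
  change term σ 0 a * term σ 1 1 = term σ 1 1 * term σ 0 (σ a)
  simp [term_mul_term]

theorem term_eq (j : ℕ) (a : R) : term σ j a = z σ ^ j * C σ a := by
  have hz : ∀ j : ℕ, z σ ^ j = term σ j 1 := by
    intro j
    induction j with
    | zero => rfl
    | succ j ih => rw [pow_succ, ih, z, term_mul_term]; simp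
  change _ = _ * term σ 0 a
  rw [hz, term_mul_term]; simp

end PiretAlgebra

/-! ### The ring `A = F[x] / (x ^ n - 1)` and its primitive idempotents -/

/-- `A = F[x] / (x ^ n - 1)`. -/
abbrev CycAlg (F : Type*) [Field F] (n : ℕ) : Type _ := AdjoinRoot (X ^ n - 1 : F[X])

/-- A factorization `x ^ n - 1 = π_1 ⋯ π_r` into pairwise different monic irreducible
polynomials, listed by nondecreasing degree. -/
structure Factorization (F : Type*) [Field F] (n r : ℕ) where
  π : Fin r → F[X]
  monic : ∀ k, (π k).Monic
  irreducible : ∀ k, Irreducible (π k)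
  injective : Function.Injective π
  prod_eq : ∏ k, π k = X ^ n - 1
  degree_mono : Monotone fun k => (π k).natDegree

namespace Factorization

variable {F : Type*} [Field F] {n r : ℕ} (fac : Factorization F n r)

theorem dvd (k : Fin r) : fac.π k ∣ X ^ n - 1 :=
  fac.prod_eq ▸ Finset.dvd_prod_of_mem fac.π (Finset.mem_univ k)

/-- The canonical projection `ρ_k : A → F[x] / (π_k)`. -/
def ρ (k : Fin r) : CycAlg F n →+* AdjoinRoot (fac.π k) :=
  (AdjoinRoot.algHomOfDvd F (X ^ n - 1) (fac.π k) (fac.dvd k)).toRingHom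

theorem ρ_mk (k : Fin r) (p : F[X]) :
    fac.ρ k (AdjoinRoot.mk _ p) = AdjoinRoot.mk (fac.π k) p := by
  have h : (AdjoinRoot.algHomOfDvd F (X ^ n - 1) (fac.π k) (fac.dvd k)).comp
      (AdjoinRoot.mkₐ (R := F) (X ^ n - 1)) = AdjoinRoot.mkₐ (fac.π k) := by
    apply Polynomial.algHom_ext
    exact AdjoinRoot.algHomOfDvd_root (X ^ n - 1) (fac.π k) (fac.dvd k)
  exact DFunLike.congr_fun h p

theorem isCoprime {i j : Fin r} (h : i ≠ j) : IsCoprime (fac.π i) (fac.π j) := by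
  rw [(fac.irreducible i).coprime_iff_not_dvd]
  intro hd
  exact h (fac.injective (Polynomial.eq_of_monic_of_associated (fac.monic i) (fac.monic j)
    ((fac.irreducible i).associated_of_dvd (fac.irreducible j) hd)))

theorem bijective : Function.Bijective (RingHom.pi fac.ρ) := by
  constructor
  · rw [injective_iff_map_eq_zero]
    intro a ha
    obtain ⟨p, rfl⟩ := AdjoinRoot.mk_surjective a
    rw [AdjoinRoot.mk_eq_zero, ← fac.prod_eq]
    refine Finset.prod_dvd_of_coprime (fun i _ j _ h => fac.isCoprime h) fun k _ => ?_
    have := congrFun ha k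
    rwa [RingHom.pi_apply, ρ_mk, Pi.zero_apply, AdjoinRoot.mk_eq_zero] at this
  · intro b
    choose q hq using fun k => AdjoinRoot.mk_surjective (b k)
    obtain ⟨p, hp⟩ := Ideal.exists_forall_sub_mem_ideal 
      (I := fun k => Ideal.span {fac.π k})
      (fun i j h => (Ideal.isCoprime_span_singleton_iff _ _).2 (fac.isCoprime h)) q
    refine ⟨AdjoinRoot.mk _ p, funext fun k => ?_⟩
    rw [RingHom.pi_apply, ρ_mk, ← hq k, AdjoinRoot.mk_eq_mk]
    exact Ideal.mem_span_singleton.1 (hp k)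

/-- The isomorphism `ψ : A → F[x] / (π_1) × ⋯ × F[x] / (π_r)`. -/
def ψ : CycAlg F n ≃+* ((k : Fin r) → AdjoinRoot (fac.π k)) :=
  RingEquiv.ofBijective (RingHom.pi fac.ρ) fac.bijective

/-- The primitive idempotent `ε_k`. -/
def ε (k : Fin r) : CycAlg F n := fac.ψ.symm (Pi.single k 1)

end Factorization

/-! ### Convolutional codes -/

section Codes

variable {F : Type*} [Field F] {n : ℕ}

/-- The submodule `im G = {u G}` of `F[z] ^ n`. -/
def im {k : ℕ} (G : Matrix (Fin k) (Fin n) F[X]) : Submodule F[X] (Fin n → F[X]) :=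
  LinearMap.range G.vecMulLinear

/-- The largest degree of a `k`-minor of a matrix with `k` rows. -/
def matrixComplexity {k : ℕ} (G : Matrix (Fin k) (Fin n) F[X]) : ℕ :=
  Finset.univ.sup fun e : Fin k ↪o Fin n => (G.submatrix id e).det.natDegree

/-- A generator matrix of a submodule of `F[z] ^ n`: its rows form a basis. -/
def generatorMatrix (S : Submodule F[X] (Fin n → F[X])) :
    Matrix (Fin (Module.finrank F[X] S)) (Fin n) F[X] :=
  Matrix.of fun i => (Module.finBasis F[X] S i : Fin n → F[X])

/-- The complexity of a submodule of `F[z] ^ n`, i.e. the complexity of any of its generator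
matrices (see `complexity_im`). -/
def complexity (S : Submodule F[X] (Fin n → F[X])) : ℕ :=
  matrixComplexity (generatorMatrix S)

theorem im_eq_span {k : ℕ} (G : Matrix (Fin k) (Fin n) F[X]) :
    im G = Submodule.span F[X] (Set.range G) :=
  range_vecMulLinear G

theorem matrixComplexity_le {k : ℕ} {G G' : Matrix (Fin k) (Fin n) F[X]}
    (hG : LinearIndependent F[X] G) (h : im G = im G') :
    matrixComplexity G ≤ matrixComplexity G' := by
  have key : ∀ {H H' : Matrix (Fin k) (Fin n) F[X]}, im H = im H' →
      ∃ V : Matrix (Fin k) (Fin k) F[X], H = V * H' := by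
    intro H H' h
    have : ∀ i, ∃ u, Matrix.vecMul u H' = H i := by
      intro i
      have hi : H i ∈ im H := by
        rw [im_eq_span]; exact Submodule.subset_span ⟨i, rfl⟩
      rw [h] at hi
      exact hi
    choose V hV using this
    exact ⟨V, funext fun i => (hV i).symm⟩
  obtain ⟨V, hV⟩ := key h
  obtain ⟨W, hW⟩ := key h.symm
  have hVW : V * W = 1 := by
    have h1 : (V * W) * G = (1 : Matrix (Fin k) (Fin k) F[X]) * G := by rw [Matrix.mul_assoc, ← hW, ← hV, Matrix.one_mul]
    refine funext fun i => ?_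
    have h2 : Matrix.vecMul ((V * W) i) G = Matrix.vecMul ((1 : Matrix (Fin k) (Fin k) F[X]) i) G :=
      congrFun h1 i
    exact (Matrix.vecMul_injective_iff.2 hG) h2
  have hu : IsUnit V.det := by
    refine IsUnit.of_mul_eq_one W.det ?_
    rw [← Matrix.det_mul, hVW, Matrix.det_one]
  unfold matrixComplexity
  refine Finset.sup_mono_fun fun e _ => ?_
  have : G.submatrix id e = V * G'.submatrix id e := by
    rw [hV]
    exact Matrix.submatrix_mul V G' id id e Function.bijective_id
  rw [this, Matrix.det_mul]
  obtain ⟨c, hc, hcV⟩ := Polynomial.isUnit_iff.1 hu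
  rw [← hcV]
  exact Polynomial.natDegree_C_mul_le c _

/-- The complexity does not depend on the generator matrix. -/
theorem complexity_im {k : ℕ} (G : Matrix (Fin k) (Fin n) F[X])
    (hG : LinearIndependent F[X] G) : complexity (im G) = matrixComplexity G := by
  have hk : Module.finrank F[X] (im G) = k := by
    rw [im_eq_span, finrank_span_eq_card hG, Fintype.card_fin]
  have aux : ∀ (S : Submodule F[X] (Fin n → F[X])), S = im G → Module.finrank F[X] S = k →
      complexity S = matrixComplexity G := by
    rintro S hS rfl
    have hli : LinearIndependent F[X] (generatorMatrix S) :=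
      (Module.finBasis F[X] S).linearIndependent.map' S.subtype S.ker_subtype
    have him : im (generatorMatrix S) = S := by
      rw [im_eq_span]
      have : Set.range (generatorMatrix S) = S.subtype '' Set.range (Module.finBasis F[X] S) := by
        rw [← Set.range_comp]; rfl
      rw [this, Submodule.span_image, (Module.finBasis F[X] S).span_eq, Submodule.map_top,
        Submodule.range_subtype]
    exact le_antisymm (matrixComplexity_le hli (him.trans hS))
      (matrixComplexity_le hG (him.trans hS).symm)
  exact aux _ rfl hk

/-- A convolutional code of length `n`: a submodule of `F[z] ^ n` having a right invertible
generator matrix. -/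
def IsConvolutionalCode (S : Submodule F[X] (Fin n → F[X])) : Prop :=
  ∃ (k : ℕ) (G : Matrix (Fin k) (Fin n) F[X]),
    (∃ G' : Matrix (Fin n) (Fin k) F[X], G * G' = 1) ∧ S = im G

/-! ### Cyclic convolutional codes -/

/-- `(v_0, …, v_{n-1}) ↦ ∑ v_i x ^ i` from `F ^ n` to `A`. -/
def vecToAlg (v : Fin n → F) : CycAlg F n :=
  ∑ i, v i • AdjoinRoot.root (X ^ n - 1 : F[X]) ^ (i : ℕ)

/-- The coefficientwise extension `∑ z ^ j v_j ↦ ∑ z ^ j 𝔭(v_j)` from `F[z] ^ n` to `A[z;σ]`,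
where `v_j` is the vector of the coefficients of `z ^ j`. -/
def pMap (σ : CycAlg F n ≃ₐ[F] CycAlg F n) (v : Fin n → F[X]) : PiretAlgebra σ :=
  ∑ j ∈ Finset.univ.biUnion fun i => (v i).support,
    PiretAlgebra.term σ j (vecToAlg fun i => (v i).coeff j)

theorem coeff_pMap (σ : CycAlg F n ≃ₐ[F] CycAlg F n) (v : Fin n → F[X]) (j : ℕ) :
    (pMap σ v).coeff j = vecToAlg fun i => (v i).coeff j := by
  have h : ∀ s : Finset ℕ, (∑ j ∈ s, PiretAlgebra.term σ j
      (vecToAlg fun i => (v i).coeff j)).coeff j =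
        if j ∈ s then vecToAlg fun i => (v i).coeff j else 0 := by
    intro s
    induction s using Finset.induction_on with
    | empty => simp [PiretAlgebra.coeff, PiretAlgebra.toPoly_zero]
    | insert a s ha ih =>
      rw [Finset.sum_insert ha, PiretAlgebra.coeff, PiretAlgebra.toPoly_add, Polynomial.coeff_add]
      rw [PiretAlgebra.coeff] at ih
      rw [ih, PiretAlgebra.toPoly_term, Polynomial.coeff_monomial]
      by_cases h1 : a = j
      · subst h1; simp [ha]
      · simp [h1, Ne.symm h1]
  rw [pMap, h]
  split_ifs with hj
  · rfl
  · simp only [Finset.mem_biUnion, Finset.mem_univ, true_and, not_exists,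
      Polynomial.mem_support_iff, not_not] at hj
    simp [vecToAlg, hj]

/-- A submodule of `F[z] ^ n` is `σ`-cyclic if its image in `A[z;σ]` is a left ideal. -/
def IsSigmaCyclic (σ : CycAlg F n ≃ₐ[F] CycAlg F n) (S : Submodule F[X] (Fin n → F[X])) :
    Prop :=
  ∃ I : Ideal (PiretAlgebra σ), (I : Set (PiretAlgebra σ)) = pMap σ '' S

/-- A `σ`-cyclic convolutional code. -/
def IsSigmaCyclicCode (σ : CycAlg F n ≃ₐ[F] CycAlg F n) (S : Submodule F[X] (Fin n → F[X])) :
    Prop :=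
  IsConvolutionalCode S ∧ IsSigmaCyclic σ S

end Codes

/-! ### Reduced polynomials and minimal codes -/

section Reduced

variable {F : Type*} [Field F] {n r : ℕ} (fac : Factorization F n r)
  {σ : CycAlg F n ≃ₐ[F] CycAlg F n}

/-- The `k`-th component `f^(k) = ε_k f`. -/
def component (k : Fin r) (f : PiretAlgebra σ) : PiretAlgebra σ :=
  PiretAlgebra.C σ (fac.ε k) * f

/-- The monomial `z ^ μ * ε_k`. -/
def mon (σ : CycAlg F n ≃ₐ[F] CycAlg F n) (μ : ℕ) (k : Fin r) : PiretAlgebra σ :=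
  PiretAlgebra.z σ ^ μ * PiretAlgebra.C σ (fac.ε k)

/-- The term `z ^ ν * ε_l * f_ν` of `f`. -/
def termOf (f : PiretAlgebra σ) (ν : ℕ) (l : Fin r) : PiretAlgebra σ :=
  mon fac σ ν l * PiretAlgebra.C σ (f.coeff ν)

/-- `z ^ μ * ε_k` is the leading monomial of `f`: the largest monomial, with respect to
`z ^ μ * ε_k < z ^ ν * ε_l ↔ μ < ν ∨ (μ = ν ∧ k < l)`, that has a nonzero coefficient in `f`.
The polynomial `0` has no leading monomial. -/
def IsLeadingMonomial (f : PiretAlgebra σ) (μ : ℕ) (k : Fin r) : Prop :=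
  fac.ε k * f.coeff μ ≠ 0 ∧
    ∀ (ν : ℕ) (l : Fin r), fac.ε l * f.coeff ν ≠ 0 → ν < μ ∨ (ν = μ ∧ l ≤ k)

/-- `f` is (left) reduced: for `k ≠ l`, no nonzero term of `f^(k)` is right divisible by the
leading monomial of `f^(l)`. -/
def IsReduced (f : PiretAlgebra σ) : Prop :=
  ∀ k l : Fin r, k ≠ l → ∀ (μ : ℕ) (m : Fin r), IsLeadingMonomial fac (component fac l f) μ m →
    ∀ (ν : ℕ) (j : Fin r), termOf fac (component fac k f) ν j ≠ 0 →
      ¬ ∃ h : PiretAlgebra σ, termOf fac (component fac k f) ν j = h * mon fac σ μ m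

/-- `g` is a generator polynomial of `S`: a reduced polynomial such that the image of `S` in
`A[z;σ]` is the left ideal `{f g}`. -/
def IsGeneratorPolynomial (S : Submodule F[X] (Fin n → F[X])) (g : PiretAlgebra σ) : Prop :=
  IsReduced fac g ∧ pMap σ '' S = {h | ∃ f : PiretAlgebra σ, h = f * g}

/-- A minimal `σ`-cyclic code: a nonzero `σ`-cyclic convolutional code whose generator polynomial
is a component. -/
def IsMinimalCode (σ : CycAlg F n ≃ₐ[F] CycAlg F n) (S : Submodule F[X] (Fin n → F[X])) : Prop :=
  IsSigmaCyclicCode σ S ∧ S ≠ ⊥ ∧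
    ∃ g : PiretAlgebra σ, IsGeneratorPolynomial fac S g ∧ ∃ l : Fin r, g = component fac l g

end Reduced

end CyclicConv

end

noncomputable section

namespace CyclicConv

open Polynomial

/-! ### Matrices all of whose maximal minors are constant -/

section Minors

variable {F : Type*} [Field F] {n k : ℕ}

/-! The bridge is `complexity_eq_zero_iff`: a code has complexity zero exactly when it is generated
by constant vectors, that is, when it contains the coefficient vectors of its elements. Through `𝔭`
these coefficient vectors become constants in `A`.

If the complexity is zero, each coefficient `g_j` is itself a multiple `f g`. Comparing constant
terms gives `g_j = f_0 g_0`, and `g_0` lies in `ε_l A` because `g = ε_l g`. Hence every `g_j` is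
fixed by `ε_l`, so `g = g ε_l`.

Conversely, let `g = g ε_l`. The code then lies in the preimage `L` of the left ideal `A[z;σ] ε_l`.
Saturation of the code forces `g_0 ≠ 0`, and `ε_l A` is a field, so right multiplication by `g`
embeds `L` into the code. The two ranks agree, and saturation gives equality with `L`, which visibly
contains all coefficient vectors.

If `σ` fixes `ε_l`, then `ε_l` is central, so `g = ε_l g = g ε_l` and the complexity is zero. -/

theorem natDegree_det_submatrix_eq_zero {G : Matrix (Fin k) (Fin n) F[X]}
    (hG : matrixComplexity G = 0) (f : Fin k → Fin n) :
    (G.submatrix id f).det.natDegree = 0 := by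
  -- `matrixComplexity` sees only increasing column selections. Sorting an injective one changes the
  -- minor by a sign; a repeated column makes it zero.
  by_cases hf : Function.Injective f
  · have hmono : StrictMono (f ∘ Tuple.sort f) :=
      (Tuple.monotone_sort f).strictMono_of_injective (hf.comp (Tuple.sort f).injective)
    have h0 : (G.submatrix id (f ∘ Tuple.sort f)).det.natDegree = 0 := by
      have hle := Finset.sup_le_iff.1 hG.le (OrderEmbedding.ofStrictMono _ hmono)
        (Finset.mem_univ _)
      rw [OrderEmbedding.coe_ofStrictMono] at hle
      exact Nat.le_zero.1 hle
    have h1 : G.submatrix id (f ∘ Tuple.sort f) =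
        (G.submatrix id f).submatrix id (Tuple.sort f) := rfl
    rw [h1, Matrix.det_permute'] at h0
    rcases Int.units_eq_one_or (Equiv.Perm.sign (Tuple.sort f)) with h | h <;>
      simpa [h] using h0
  · simp only [Function.Injective, not_forall] at hf
    obtain ⟨i, j, hij, hne⟩ := hf
    rw [Matrix.det_zero_of_column_eq hne fun m => by simp [hij], natDegree_zero]

/-- As in Cauchy–Binet: each column of `G * G'` is a combination of columns of `G`, so expanding the
determinant multilinearly writes `1` as a combination of the minors of `G`. -/
theorem exists_det_submatrix_ne_zero {R : Type*} [CommRing R] [Nontrivial R]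
    {G : Matrix (Fin k) (Fin n) R} {G' : Matrix (Fin n) (Fin k) R} (h : G * G' = 1) :
    ∃ f : Fin k → Fin n, (G.submatrix id f).det ≠ 0 := by
  by_contra! hf
  have hrow : (G * G').transpose = fun i => ∑ m, G' m i • G.transpose m := by
    funext i j
    simp [Matrix.mul_apply, Finset.sum_apply, mul_comm]
  have hdet : (G * G').transpose.det = 0 := by
    rw [hrow]
    change Matrix.detRowAlternating (fun i => ∑ m, G' m i • G.transpose m) = 0
    rw [← AlternatingMap.coe_multilinearMap, MultilinearMap.map_sum]
    refine Finset.sum_eq_zero fun f _ => ?_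
    rw [MultilinearMap.map_smul_univ]
    have : Matrix.detRowAlternating (fun i => G.transpose (f i)) = 0 := by
      rw [← hf f, ← Matrix.det_transpose]
      rfl
    rw [AlternatingMap.coe_multilinearMap, this, smul_zero]
  rw [h, Matrix.transpose_one, Matrix.det_one] at hdet
  exact one_ne_zero hdet

/-- A right invertible matrix over `F[z]` all of whose maximal minors are constant has the same
row space as a constant matrix. -/
theorem exists_im_map_C_eq {G : Matrix (Fin k) (Fin n) F[X]} {G' : Matrix (Fin n) (Fin k) F[X]}
    (h : G * G' = 1) (hG : matrixComplexity G = 0) :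
    ∃ H : Matrix (Fin k) (Fin n) F, im G = im (H.map C) := by
  obtain ⟨f, hf⟩ := exists_det_submatrix_ne_zero h
  set M := G.submatrix id f with hM
  obtain ⟨c, hc⟩ := natDegree_eq_zero.1 (natDegree_det_submatrix_eq_zero hG f)
  have hc0 : c ≠ 0 := by
    rintro rfl
    exact hf (by rw [← hc, C_0])
  have hunit : IsUnit M.det := by
    rw [← hc]
    exact isUnit_C.2 hc0.isUnit
  have hentry : ∀ i j, ∃ b : F, C b = (M⁻¹ * G) i j := by
    intro i j
    -- Cramer's rule: up to the factor `det M`, an entry of `M⁻¹ G` is again a maximal minor of `G`,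
    -- with one selected column replaced, hence constant.
    have h1 : (M.det • (M⁻¹ * G)) i j = (G.submatrix id (Function.update f i j)).det := by
      have h2 : G.submatrix id (Function.update f i j) = M.updateCol i fun a => G a j := by
        ext a b
        by_cases hb : b = i
        · subst hb; simp
        · simp [hM, hb]
      rw [h2, ← Matrix.cramer_apply, Matrix.cramer_eq_adjugate_mulVec, ← Matrix.smul_mul,
        Matrix.inv_def, smul_smul, Ring.mul_inverse_cancel _ hunit, one_smul]
      rfl
    obtain ⟨d, hd⟩ := natDegree_eq_zero.1
      (natDegree_det_submatrix_eq_zero hG (Function.update f i j))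
    refine ⟨c⁻¹ * d, ?_⟩
    rw [C_mul, hd, ← h1, ← hc, Matrix.smul_apply, smul_eq_mul, ← mul_assoc, ← C_mul,
      inv_mul_cancel₀ hc0, C_1, one_mul]
  choose H hH using hentry
  refine ⟨Matrix.of H, ?_⟩
  have hHG : (Matrix.of H).map C = M⁻¹ * G := by
    ext1 i j
    exact hH i j
  rw [hHG]
  have hle : ∀ (V : Matrix (Fin k) (Fin k) F[X]) (K : Matrix (Fin k) (Fin n) F[X]),
      im (V * K) ≤ im K := by
    rintro V K _ ⟨u, rfl⟩
    exact ⟨Matrix.vecMul u V, Matrix.vecMul_vecMul u V K⟩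
  refine le_antisymm ?_ (hle _ _)
  have := hle M (M⁻¹ * G)
  rwa [← Matrix.mul_assoc, Matrix.mul_nonsing_inv _ hunit, Matrix.one_mul] at this

theorem linearIndependent_of_mul_eq_one {R : Type*} [CommRing R] {G : Matrix (Fin k) (Fin n) R}
    {G' : Matrix (Fin n) (Fin k) R} (h : G * G' = 1) : LinearIndependent R G := by
  refine Matrix.vecMul_injective_iff.1 fun u v huv => ?_
  have := congrArg (fun w => Matrix.vecMul w G') huv
  simpa [Matrix.vecMul_vecMul, h] using this

/-- The constant vector of the coefficients of `z ^ j`. -/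
def coeffVec (v : Fin n → F[X]) (j : ℕ) : Fin n → F[X] := fun i => C ((v i).coeff j)

/-- A convolutional code has complexity zero if and only if it contains the coefficient vectors of
its elements. -/
theorem complexity_eq_zero_iff {S : Submodule F[X] (Fin n → F[X])} (hS : IsConvolutionalCode S) :
    complexity S = 0 ↔ ∀ v ∈ S, ∀ j, coeffVec v j ∈ S := by
  obtain ⟨k, G, ⟨G', hGG'⟩, rfl⟩ := hS
  rw [complexity_im G (linearIndependent_of_mul_eq_one hGG')]
  constructor
  · intro hG
    obtain ⟨H, hH⟩ := exists_im_map_C_eq hGG' hG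
    rw [hH]
    rintro _ ⟨u, rfl⟩ j
    refine ⟨fun i => C ((u i).coeff j), ?_⟩
    funext m
    simp [coeffVec, Matrix.vecMul, dotProduct, finsetSum_coeff]
  · intro hcl
    -- `φ` sets `z = 0`. The aim is that `G` and the constant matrix `G(0)` have the same row space,
    -- so that the minors of `G(0)` bound the complexity.
    set φ : F[X] →+* F[X] := C.comp (evalRingHom 0) with hφ
    have hφc : ∀ p : F[X], φ p = C (p.coeff 0) := by
      intro p
      simp [hφ, coeff_zero_eq_eval_zero]
    have h0 : G.map φ * G'.map φ = 1 := by
      rw [← Matrix.map_mul, hGG', Matrix.map_one _ (map_zero _) (map_one _)]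
    have him : im G = im (G.map φ) := by
      apply le_antisymm
      · intro v hv
        have hmem : ∀ j, coeffVec v j ∈ im (G.map φ) := by
          intro j
          obtain ⟨u, hu⟩ := hcl v hv j
          -- A constant vector is unchanged by `φ`, so `w = u G` yields `w = u(0) G(0)`.
          refine ⟨fun i => φ (u i), ?_⟩
          have h1 : coeffVec v j = fun i => φ (coeffVec v j i) := by
            funext i
            rw [hφc, coeffVec, coeff_C_zero]
          rw [h1, ← hu]
          funext i
          exact (RingHom.map_vecMul φ G u i).symm
        have hv' : v = ∑ j ∈ Finset.univ.biUnion fun i => (v i).support,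
            (X ^ j : F[X]) • coeffVec v j := by
          funext i
          rw [Finset.sum_apply]
          conv_lhs => rw [(v i).as_sum_support_C_mul_X_pow]
          refine Finset.sum_subset_zero_on_sdiff
            (Finset.subset_biUnion_of_mem (fun i => (v i).support) (Finset.mem_univ i))
            (fun j hj => ?_) fun j _ => ?_
          · have : (v i).coeff j = 0 := notMem_support_iff.1 (Finset.mem_sdiff.1 hj).2
            simp [coeffVec, this]
          · exact mul_comm _ _
        rw [hv']
        exact Submodule.sum_mem _ fun j _ => Submodule.smul_mem _ _ (hmem j)
      · rw [im_eq_span (G.map φ), Submodule.span_le]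
        rintro _ ⟨i, rfl⟩
        have hi : G i ∈ im G := by
          rw [im_eq_span]
          exact Submodule.subset_span ⟨i, rfl⟩
        have h1 : G.map φ i = coeffVec (G i) 0 := by
          funext j
          exact hφc _
        rw [SetLike.mem_coe, h1]
        exact hcl _ hi 0
    have hli := linearIndependent_of_mul_eq_one hGG'
    refine Nat.le_zero.1 ((matrixComplexity_le hli him).trans ?_)
    refine Finset.sup_le fun e _ => ?_
    have h1 : (G.map φ).submatrix id e = φ.mapMatrix (G.submatrix id e) := rfl
    rw [h1, ← RingHom.map_det, hφc, natDegree_C]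

/-- A convolutional code is saturated. -/
theorem IsConvolutionalCode.mem_of_smul_mem {S : Submodule F[X] (Fin n → F[X])}
    (hS : IsConvolutionalCode S) {q : F[X]} (hq : q ≠ 0) {v : Fin n → F[X]} (hv : q • v ∈ S) :
    v ∈ S := by
  obtain ⟨k, G, ⟨G', hGG'⟩, rfl⟩ := hS
  obtain ⟨u, hu⟩ := hv
  rw [Matrix.vecMulLinear_apply] at hu
  refine ⟨Matrix.vecMul v G', ?_⟩
  rw [Matrix.vecMulLinear_apply]
  have h1 : u = q • Matrix.vecMul v G' := by
    rw [← Matrix.smul_vecMul, ← hu, Matrix.vecMul_vecMul, hGG', Matrix.vecMul_one]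
  rw [h1, Matrix.smul_vecMul] at hu
  exact smul_right_injective _ hq hu

end Minors

/-! ### Coefficients and the `F[z]`-module structure of `R[z;σ]` -/

namespace PiretAlgebra

variable {F R : Type*} [CommSemiring F] [CommRing R] [Algebra F R] {σ : R ≃ₐ[F] R}

theorem coeff_add (f g : PiretAlgebra σ) (j : ℕ) : (f + g).coeff j = f.coeff j + g.coeff j :=
  Polynomial.coeff_add _ _ _

theorem coeff_zero (j : ℕ) : (0 : PiretAlgebra σ).coeff j = 0 :=
  Polynomial.coeff_zero _

theorem coeff_term (i : ℕ) (a : R) (j : ℕ) : (term σ i a).coeff j = if i = j then a else 0 :=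
  Polynomial.coeff_monomial

theorem ext {f g : PiretAlgebra σ} (h : ∀ j, f.coeff j = g.coeff j) : f = g :=
  toPoly_injective (Polynomial.ext h)

theorem coeff_C (a : R) (j : ℕ) : (C σ a).coeff j = if 0 = j then a else 0 :=
  coeff_term 0 a j

theorem coeff_mul_zero (f g : PiretAlgebra σ) : (f * g).coeff 0 = f.coeff 0 * g.coeff 0 := by
  induction f using induction_on with
  | add f₁ f₂ h₁ h₂ => rw [add_mul, coeff_add, coeff_add, h₁, h₂, add_mul]
  | mon i a =>
    induction g using induction_on with
    | add g₁ g₂ h₁ h₂ => rw [mul_add, coeff_add, coeff_add, h₁, h₂, mul_add]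
    | mon j b =>
      rw [term_mul_term, coeff_term, coeff_term, coeff_term]
      rcases i with _ | i <;> rcases j with _ | j <;> simp

theorem coeff_mul_C (f : PiretAlgebra σ) (a : R) (j : ℕ) :
    (f * C σ a).coeff j = f.coeff j * a := by
  induction f using induction_on with
  | add f₁ f₂ h₁ h₂ => rw [add_mul, coeff_add, coeff_add, h₁, h₂, add_mul]
  | mon i b =>
    change (term σ i b * term σ 0 a).coeff j = _
    rw [term_mul_term, coeff_term, coeff_term]
    split_ifs <;> simp_all

theorem coeff_C_mul (f : PiretAlgebra σ) (a : R) (j : ℕ) :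
    (C σ a * f).coeff j = (σ ^ j) a * f.coeff j := by
  induction f using induction_on with
  | add f₁ f₂ h₁ h₂ => rw [mul_add, coeff_add, coeff_add, h₁, h₂, mul_add]
  | mon i b =>
    change (term σ 0 a * term σ i b).coeff j = _
    rw [term_mul_term, coeff_term, coeff_term]
    split_ifs <;> simp_all

theorem coeff_z_mul_zero (f : PiretAlgebra σ) : (z σ * f).coeff 0 = 0 := by
  rw [coeff_mul_zero, z, coeff_term]
  simp

theorem coeff_z_mul_succ (f : PiretAlgebra σ) (j : ℕ) : (z σ * f).coeff (j + 1) = f.coeff j := by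
  induction f using induction_on with
  | add f₁ f₂ h₁ h₂ => rw [mul_add, coeff_add, coeff_add, h₁, h₂]
  | mon i a =>
    rw [z, term_mul_term, coeff_term, coeff_term, add_comm 1 i]
    simp

/-- With coefficients on the right, left multiplication by `z` is an untwisted shift, so ordinary
division by the variable inverts it. -/
theorem exists_eq_z_mul {f : PiretAlgebra σ} (hf : f.coeff 0 = 0) : ∃ h, f = z σ * h := by
  refine ⟨⟨f.toPoly.divX⟩, ext fun j => ?_⟩
  rcases j with _ | j
  · rw [hf, coeff_z_mul_zero]
  · rw [coeff_z_mul_succ]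
    exact (Polynomial.coeff_divX).symm

theorem z_mul_injective : Function.Injective fun f : PiretAlgebra σ => z σ * f := by
  intro f g h
  refine ext fun j => ?_
  rw [← coeff_z_mul_succ, ← coeff_z_mul_succ g]
  exact congrArg (fun f => coeff f (j + 1)) h

/-- The embedding `F[z] → R[z;σ]`. -/
def ofPoly (σ : R ≃ₐ[F] R) : F[X] →+* PiretAlgebra σ :=
  -- Evaluation at `z` is multiplicative because `σ` fixes the scalars, which therefore commute with
  -- `z`.
  eval₂RingHom' ((C σ).comp (algebraMap F R)) (z σ) fun a => by
    change C σ (algebraMap F R a) * z σ = z σ * C σ (algebraMap F R a)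
    rw [C_mul_z, AlgEquiv.commutes]

theorem ofPoly_C (a : F) : ofPoly σ (Polynomial.C a) = C σ (algebraMap F R a) :=
  eval₂_C _ _

theorem ofPoly_X : ofPoly σ X = z σ :=
  eval₂_X _ _

instance : Module F[X] (PiretAlgebra σ) := Module.compHom _ (ofPoly σ)

theorem poly_smul_def (q : F[X]) (f : PiretAlgebra σ) : q • f = ofPoly σ q * f := rfl

/-- Right multiplication by `g`, as an `F[z]`-linear map. -/
def mulRight (g : PiretAlgebra σ) : PiretAlgebra σ →ₗ[F[X]] PiretAlgebra σ where
  toFun f := f * g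
  map_add' f₁ f₂ := add_mul f₁ f₂ g
  map_smul' _ f := mul_assoc _ f g

end PiretAlgebra

/-! ### The component `ε_l A` -/

namespace Factorization

variable {F : Type*} [Field F] {n r : ℕ} (fac : Factorization F n r)

theorem ε_mul_self (l : Fin r) : fac.ε l * fac.ε l = fac.ε l := by
  rw [ε, ← map_mul, ← Pi.single_mul, one_mul]

/-- `ε_l A` has no zero divisors. -/
theorem eq_zero_of_mul_eq_zero {l : Fin r} {a b : CycAlg F n} (ha : a = a * fac.ε l)
    (hb : b = fac.ε l * b) (hb0 : b ≠ 0) (hab : a * b = 0) : a = 0 := by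
  have : Fact (Irreducible (fac.π l)) := ⟨fac.irreducible l⟩
  have hψε : fac.ψ (fac.ε l) = Pi.single l 1 := fac.ψ.apply_symm_apply _
  -- Under `ψ` both elements live in the single coordinate `l`, which is a field.
  have ha' : ∀ k, k ≠ l → fac.ψ a k = 0 := by
    intro k hk
    rw [ha, map_mul, hψε, Pi.mul_apply, Pi.single_eq_of_ne hk, mul_zero]
  have hb' : ∀ k, k ≠ l → fac.ψ b k = 0 := by
    intro k hk
    rw [hb, map_mul, hψε, Pi.mul_apply, Pi.single_eq_of_ne hk, zero_mul]
  have hbl : fac.ψ b l ≠ 0 := by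
    intro h
    refine hb0 (fac.ψ.injective ?_)
    rw [map_zero]
    funext k
    rcases eq_or_ne k l with rfl | hk
    exacts [h, hb' k hk]
  have hal : fac.ψ a l * fac.ψ b l = 0 := by
    rw [← Pi.mul_apply, ← map_mul, hab, map_zero, Pi.zero_apply]
  apply fac.ψ.injective
  rw [map_zero]
  funext k
  rcases eq_or_ne k l with rfl | hk
  exacts [(mul_eq_zero.1 hal).resolve_right hbl, ha' k hk]

end Factorization

/-! ### `𝔭` as an injective `F[z]`-linear map -/

section PMap

variable {F : Type*} [Field F] {n : ℕ}

theorem vecToAlg_add (v w : Fin n → F) : vecToAlg (v + w) = vecToAlg v + vecToAlg w := by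
  simp [vecToAlg, add_smul, Finset.sum_add_distrib]

theorem vecToAlg_smul (c : F) (v : Fin n → F) : vecToAlg (c • v) = c • vecToAlg v := by
  simp only [vecToAlg, Finset.smul_sum, Pi.smul_apply, smul_eq_mul, mul_smul]

/-- For `n ≠ 0` the modulus is monic of degree `n`, so the first `n` powers of the root form a
basis. -/
theorem vecToAlg_injective (hn : n ≠ 0) : Function.Injective (vecToAlg (F := F) (n := n)) := by
  have hm : (X ^ n - 1 : F[X]).Monic := monic_X_pow_sub_C 1 hn
  have hd : (AdjoinRoot.powerBasis' hm).dim = n := by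
    rw [AdjoinRoot.powerBasis'_dim]
    exact natDegree_X_pow_sub_C
  have h : ∀ v : Fin n → F, vecToAlg v =
      ((AdjoinRoot.powerBasis' hm).basis.reindex (finCongr hd)).equivFun.symm v := by
    intro v
    rw [Module.Basis.equivFun_symm_apply, vecToAlg]
    simp
  intro v w hvw
  rw [h, h] at hvw
  exact LinearEquiv.injective _ hvw

variable {σ : CycAlg F n ≃ₐ[F] CycAlg F n}

theorem pMap_add (v w : Fin n → F[X]) : pMap σ (v + w) = pMap σ v + pMap σ w := by
  refine PiretAlgebra.ext fun j => ?_
  rw [PiretAlgebra.coeff_add, coeff_pMap, coeff_pMap, coeff_pMap, ← vecToAlg_add]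
  exact congrArg _ (funext fun i => Polynomial.coeff_add _ _ _)

theorem pMap_C_smul (c : F) (v : Fin n → F[X]) :
    pMap σ ((C c : F[X]) • v) = (C c : F[X]) • pMap σ v := by
  refine PiretAlgebra.ext fun j => ?_
  rw [PiretAlgebra.poly_smul_def, PiretAlgebra.ofPoly_C, PiretAlgebra.coeff_C_mul,
    AlgEquiv.commutes, ← Algebra.smul_def, coeff_pMap, coeff_pMap, ← vecToAlg_smul]
  exact congrArg _ (funext fun i => Polynomial.coeff_C_mul _)

theorem pMap_X_smul (v : Fin n → F[X]) : pMap σ ((X : F[X]) • v) = (X : F[X]) • pMap σ v := by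
  refine PiretAlgebra.ext fun j => ?_
  rw [PiretAlgebra.poly_smul_def, PiretAlgebra.ofPoly_X, coeff_pMap]
  rcases j with _ | j
  · rw [PiretAlgebra.coeff_z_mul_zero]
    simp [vecToAlg]
  · rw [PiretAlgebra.coeff_z_mul_succ, coeff_pMap]
    exact congrArg _ (funext fun i => Polynomial.coeff_X_mul _ _)

theorem pMap_smul (q : F[X]) (v : Fin n → F[X]) : pMap σ (q • v) = q • pMap σ v := by
  induction q using Polynomial.induction_on generalizing v with
  | C a => exact pMap_C_smul a v
  | add p q hp hq => rw [add_smul, pMap_add, hp, hq, add_smul]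
  | monomial m a ih =>
    rw [pow_succ, ← mul_assoc, mul_smul, ih, pMap_X_smul, mul_smul _ X]

variable (σ) in
/-- The map `𝔭` is `F[z]`-linear. -/
def pLinear : (Fin n → F[X]) →ₗ[F[X]] PiretAlgebra σ where
  toFun := pMap σ
  map_add' := pMap_add
  map_smul' := pMap_smul

theorem pMap_injective (hn : n ≠ 0) : Function.Injective (pMap σ) := by
  intro v w h
  funext i
  ext j
  have hj : (pMap σ v).coeff j = (pMap σ w).coeff j := by rw [h]
  rw [coeff_pMap, coeff_pMap] at hj
  exact congrFun (vecToAlg_injective hn hj) i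

theorem pMap_coeffVec (v : Fin n → F[X]) (j : ℕ) :
    pMap σ (coeffVec v j) = PiretAlgebra.C σ ((pMap σ v).coeff j) := by
  refine PiretAlgebra.ext fun m => ?_
  rw [coeff_pMap, coeff_pMap, PiretAlgebra.coeff_C]
  rcases m with _ | m
  · simp [coeffVec]
  · simp [coeffVec, vecToAlg]

end PMap

/-! ### Codes of complexity zero -/

section Complexity

variable {F : Type*} [Field F] {n r : ℕ} {fac : Factorization F n r}
  {σ : CycAlg F n ≃ₐ[F] CycAlg F n} {S : Submodule F[X] (Fin n → F[X])} {g : PiretAlgebra σ}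
  {l : Fin r}

theorem coeff_zero_eq_of_eq_component (hl : g = component fac l g) :
    g.coeff 0 = fac.ε l * g.coeff 0 := by
  conv_lhs => rw [hl, component, PiretAlgebra.coeff_C_mul]
  simp

theorem mem_iff_exists_mul (hn : n ≠ 0) (hS : pMap σ '' S = {h | ∃ f, h = f * g})
    {v : Fin n → F[X]} : v ∈ S ↔ ∃ f, pMap σ v = f * g := by
  constructor
  · intro hv
    have : pMap σ v ∈ pMap σ '' S := ⟨v, hv, rfl⟩
    rwa [hS] at this
  · intro hv
    have : pMap σ v ∈ pMap σ '' S := hS ▸ hv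
    obtain ⟨w, hw, hwv⟩ := this
    exact pMap_injective hn hwv ▸ hw

/-- If `g_0 = 0`, every codeword is divisible by `z`. By saturation the quotient is again a
codeword, so codewords are divisible by all powers of `z` and vanish. -/
theorem coeff_zero_ne_zero (hn : n ≠ 0) (hcode : IsConvolutionalCode S) (hbot : S ≠ ⊥)
    (hS : pMap σ '' S = {h | ∃ f, h = f * g}) : g.coeff 0 ≠ 0 := by
  intro hg0
  have hzero : ∀ j, ∀ v ∈ S, ∀ i, (v i).coeff j = 0 := by
    have h0 : ∀ v ∈ S, ∀ i, (v i).coeff 0 = 0 := by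
      intro v hv i
      obtain ⟨f, hf⟩ := (mem_iff_exists_mul hn hS).1 hv
      have h1 : (pMap σ v).coeff 0 = 0 := by
        rw [hf, PiretAlgebra.coeff_mul_zero, hg0, mul_zero]
      rw [coeff_pMap] at h1
      refine congrFun (vecToAlg_injective hn (a₁ := fun i => (v i).coeff 0) (a₂ := 0) ?_) i
      rw [h1]
      simp [vecToAlg]
    intro j
    induction j with
    | zero => exact h0
    | succ j ih =>
      intro v hv i
      have hX : v = (X : F[X]) • fun i => (v i).divX := by
        funext m
        conv_lhs => rw [← divX_mul_X_add (v m), h0 v hv m, C_0, add_zero, mul_comm]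
        rfl
      have := ih _ (hcode.mem_of_smul_mem X_ne_zero (hX ▸ hv)) i
      rwa [coeff_divX] at this
  refine hbot ((Submodule.eq_bot_iff S).2 fun v hv => funext fun i => ?_)
  ext j
  exact hzero j v hv i

theorem eq_mul_ε_of_complexity_eq_zero (hn : n ≠ 0) (hcode : IsConvolutionalCode S)
    (hS : pMap σ '' S = {h | ∃ f, h = f * g}) (hl : g = component fac l g)
    (hc : complexity S = 0) : g = g * PiretAlgebra.C σ (fac.ε l) := by
  obtain ⟨v, hv, hvg⟩ : g ∈ pMap σ '' S := by
    rw [hS]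
    exact ⟨1, (one_mul g).symm⟩
  refine PiretAlgebra.ext fun j => ?_
  obtain ⟨f, hf⟩ := (mem_iff_exists_mul hn hS).1 ((complexity_eq_zero_iff hcode).1 hc v hv j)
  rw [pMap_coeffVec, hvg] at hf
  have h0 := congrArg (fun f => PiretAlgebra.coeff f 0) hf
  simp only [PiretAlgebra.coeff_C, if_true, PiretAlgebra.coeff_mul_zero] at h0
  rw [PiretAlgebra.coeff_mul_C, h0, coeff_zero_eq_of_eq_component hl]
  linear_combination (-(f.coeff 0 * g.coeff 0)) * fac.ε_mul_self l

/-- The constant term of `f g` is `f_0 g_0`, a product in the field `ε_l A`, so `f_0 = 0`. Then `z`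
can be cancelled on the left and the argument repeated. -/
theorem eq_zero_of_mul_eq_zero (hl : g = component fac l g) (hg0 : g.coeff 0 ≠ 0)
    {f : PiretAlgebra σ} (hf : f = f * PiretAlgebra.C σ (fac.ε l)) (hfg : f * g = 0) : f = 0 := by
  have hzero : ∀ j, ∀ f : PiretAlgebra σ, f = f * PiretAlgebra.C σ (fac.ε l) → f * g = 0 →
      f.coeff j = 0 := by
    have h0 : ∀ f : PiretAlgebra σ, f = f * PiretAlgebra.C σ (fac.ε l) → f * g = 0 →
        f.coeff 0 = 0 := by
      intro f hf hfg
      refine fac.eq_zero_of_mul_eq_zero (l := l) (b := g.coeff 0) ?_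
        (coeff_zero_eq_of_eq_component hl) hg0 ?_
      · rw [← PiretAlgebra.coeff_mul_C, ← hf]
      · rw [← PiretAlgebra.coeff_mul_zero, hfg, PiretAlgebra.coeff_zero]
    intro j
    induction j with
    | zero => exact h0
    | succ j ih =>
      intro f hf hfg
      obtain ⟨h, rfl⟩ := PiretAlgebra.exists_eq_z_mul (h0 f hf hfg)
      rw [PiretAlgebra.coeff_z_mul_succ]
      refine ih h (PiretAlgebra.z_mul_injective ?_) (PiretAlgebra.z_mul_injective ?_)
      · rwa [mul_assoc] at hf
      · rw [mul_assoc] at hfg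
        simpa using hfg
  exact PiretAlgebra.ext fun j => (hzero j f hf hfg).trans (PiretAlgebra.coeff_zero j).symm

/-- If `N` and `M` are submodules of equal finite rank with `N ≤ M`, then `M` is torsion modulo
`N`. -/
theorem exists_smul_mem_of_finrank_le {R V : Type*} [CommRing R] [IsDomain R] [AddCommGroup V]
    [Module R V] {N M : Submodule R V} [Module.Finite R M] (hNM : N ≤ M)
    (h : Module.finrank R M ≤ Module.finrank R N) {v : V} (hv : v ∈ M) :
    ∃ q : R, q ≠ 0 ∧ q • v ∈ N := by
  have h1 := Submodule.finrank_quotient_add_finrank (N.submoduleOf M)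
  rw [(Submodule.submoduleOfEquivOfLe hNM).finrank_eq] at h1
  -- Equal ranks leave a quotient of rank zero, and over a domain that means torsion.
  have h2 : Module.finrank R (M ⧸ N.submoduleOf M) = 0 := by omega
  obtain ⟨q, hq⟩ := Module.finrank_eq_zero_iff_isTorsion.1 h2
    (x := (N.submoduleOf M).mkQ ⟨v, hv⟩)
  refine ⟨q, nonZeroDivisors.ne_zero q.2, ?_⟩
  have h3 : (N.submoduleOf M).mkQ ((q : R) • ⟨v, hv⟩) = 0 := hq
  rw [Submodule.mkQ_apply, Submodule.Quotient.mk_eq_zero] at h3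
  exact h3

theorem complexity_eq_zero_of_eq_mul_ε (hn : n ≠ 0) (hcode : IsConvolutionalCode S)
    (hbot : S ≠ ⊥) (hS : pMap σ '' S = {h | ∃ f, h = f * g}) (hl : g = component fac l g)
    (hg : g = g * PiretAlgebra.C σ (fac.ε l)) : complexity S = 0 := by
  have hg0 := coeff_zero_ne_zero hn hcode hbot hS
  -- `L` is the preimage of `A[z;σ] ε_l`, the largest candidate for the code; the rest shows that
  -- the code fills it.
  let L : Submodule F[X] (Fin n → F[X]) := LinearMap.eqLocus (pLinear σ)
    ((PiretAlgebra.mulRight (PiretAlgebra.C σ (fac.ε l))).comp (pLinear σ))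
  have hL : ∀ v, v ∈ L ↔ pMap σ v = pMap σ v * PiretAlgebra.C σ (fac.ε l) := fun v => Iff.rfl
  have hSL : S ≤ L := by
    intro v hv
    obtain ⟨f, hf⟩ := (mem_iff_exists_mul hn hS).1 hv
    rw [hL, hf, mul_assoc, ← hg]
  let φ : L →ₗ[F[X]] PiretAlgebra σ :=
    (PiretAlgebra.mulRight g).comp ((pLinear σ).comp L.subtype)
  have hφ : Function.Injective φ := by
    rw [← LinearMap.ker_eq_bot, LinearMap.ker_eq_bot']
    rintro ⟨v, hv⟩ hv0
    have h1 : pMap σ v = 0 := eq_zero_of_mul_eq_zero hl hg0 ((hL v).1 hv) hv0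
    exact Subtype.ext (pMap_injective hn (h1.trans (pLinear σ).map_zero.symm))
  have hrange : LinearMap.range φ ≤ S.map (pLinear σ) := by
    rintro _ ⟨v, rfl⟩
    have : φ v ∈ pMap σ '' S := by
      rw [hS]
      exact ⟨pMap σ v, rfl⟩
    exact this
  have hrank : Module.finrank F[X] L ≤ Module.finrank F[X] S := by
    rw [(LinearEquiv.ofInjective φ hφ).finrank_eq]
    exact (Submodule.finrank_mono hrange).trans
      (Submodule.equivMapOfInjective (pLinear σ) (pMap_injective hn) S).finrank_eq.ge
  have hLS : L ≤ S := by
    intro v hv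
    obtain ⟨q, hq, hqv⟩ := exists_smul_mem_of_finrank_le hSL hrank hv
    exact hcode.mem_of_smul_mem hq hqv
  -- Membership in `L` is tested coefficient by coefficient, since right multiplication by a
  -- constant involves no twist.
  refine (complexity_eq_zero_iff hcode).2 fun v hv j => hLS ?_
  rw [hL, pMap_coeffVec, ← map_mul, ← PiretAlgebra.coeff_mul_C, ← (hL v).1 (hSL hv)]

theorem eq_mul_ε_of_map_ε_eq (hl : g = component fac l g) (hσ : σ (fac.ε l) = fac.ε l) :
    g = g * PiretAlgebra.C σ (fac.ε l) := by
  have hpow : ∀ j : ℕ, (σ ^ j) (fac.ε l) = fac.ε l := by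
    intro j
    induction j with
    | zero => rfl
    | succ j ih => rw [pow_succ, AlgEquiv.mul_apply, hσ, ih]
  conv_lhs => rw [hl]
  refine PiretAlgebra.ext fun j => ?_
  rw [component, PiretAlgebra.coeff_C_mul, PiretAlgebra.coeff_mul_C, hpow, mul_comm]

end Complexity

end CyclicConv

end

theorem mainTheorem10 {F : Type*} [Field F] [Finite F] {n r : ℕ}
    (hn : n.Coprime (Nat.card F)) (fac : CyclicConv.Factorization F n r)
    (σ : CyclicConv.CycAlg F n ≃ₐ[F] CyclicConv.CycAlg F n)
    (S : Submodule (Polynomial F) (Fin n → Polynomial F))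
    (hS : CyclicConv.IsMinimalCode fac σ S)
    (g : CyclicConv.PiretAlgebra σ) (hg : CyclicConv.IsGeneratorPolynomial fac S g)
    (l : Fin r) (hl : g = CyclicConv.component fac l g) :
    (CyclicConv.complexity S = 0 ↔ g = g * CyclicConv.PiretAlgebra.C σ (fac.ε l)) ∧
      (CyclicConv.complexity S ≠ 0 → σ (fac.ε l) ≠ fac.ε l) := by
  -- Coprimality excludes `n = 0`, as it would force `|F| = 1`.
  have hn0 : n ≠ 0 := by
    rintro rfl
    exact Finite.one_lt_card.ne' ((Nat.coprime_zero_left _).1 hn)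
  obtain ⟨⟨hcode, -⟩, hbot, -⟩ := hS
  have hback := CyclicConv.complexity_eq_zero_of_eq_mul_ε hn0 hcode hbot hg.2 hl
  exact ⟨⟨CyclicConv.eq_mul_ε_of_complexity_eq_zero hn0 hcode hg.2 hl, hback⟩,
    fun hc hσ => hc (hback (CyclicConv.eq_mul_ε_of_map_ε_eq hl hσ))⟩
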